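/- Let $k$ be a field. A GDN-Poisson algebra over $k$ is a $k$-vector space with bilinear operations $\cdot,\circ$ such that $\cdot$ is commutative and associative with unit $e$, and for all $x,y,z$ $$x\circ(y\circ z)-(x\circ y)\circ z=y\circ(x\circ z)-(y\circ x)\circ z,\qquad (x\circ y)\circ z=(x\circ z)\circ y,$$ $$(x\cdot y)\circ z=x\cdot(y\circ z),\qquad (x\circ y)\cdot z-x\circ(y\cdot z)=(y\circ x)\cdot z-y\circ(x\cdot z).$$ A special GDN-Poisson admissible algebra over $k$ is a $k$-vector space with bilinear operations $\cdot,\ast$ and a linear operation $D$ such that $\cdot$ is commutative and associative with unit $e$, $\ast$ is commutative and associative, and for all $x,y,z$ $$(x\cdot y)\ast z=x\cdot(y\ast z),\quad D(x\ast y)=(Dx)\ast y+x\ast(Dy),\quad D(x\cdot y)=(Dx)\cdot y+x\cdot(Dy)-x\cdot y\cdot(De).$$ Such an algebra is a GDN-Poisson algebra with respect to $\cdot$ and $x\circ y:=x\ast Dy$. Homomorphisms preserve all operations and the unit; ideals are two-sided for every binary operation and, in the admissible case, stable under $D$. Let $GDNP(X)$ and $C(X)$ be the free GDN-Poisson algebra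 and the free special GDN-Poisson admissible algebra generated by a set $X$, and let $\varphi\colon GDNP(X)\to C(X)$ be the homomorphism of GDN-Poisson algebras with $\varphi(x)=x$ for $x\in X$. For $S\subseteq GDNP(X)$ let $GDNP(X|S)=GDNP(X)/Id(S)$ and $C(X|S)=C(X)/Id[\varphi(S)]$, where $Id(S)$ is the ideal of the GDN-Poisson algebra $GDNP(X)$ generated by $S$, and $Id[\varphi(S)]$ is the ideal of the special GDN-Poisson admissible algebra $C(X)$ generated by $\varphi(S)$. Let $GDNP_0(X)$ be the $k$-subspace of $C(X)$ spanned by all words $w=D^{i_1}a_1\ast\cdots\ast D^{i_j}a_j\cdot D^{i_{j+1}}a_{j+1}\cdots D^{i_n}a_n$ ($1\le j\le n$, $i_t\ge 0$, $a_t\in X\cup\{e\}$, and no letter equal to $D^0e$ if $j<n$) of weight $\sum_t i_t-(j-1)=0$. **Theorem 3.1 (PBW theorem).** For every set $X$ and every $S\subseteq GDNP(X)$: 1. $\varphi$ is injective with image $GDNP_0(X)$, so $GDNP(X)\cong GDNP_0(X)$ as GDN-Poisson algebras; 2. the ideal of the GDN-Poisson algebra $GDNP_0(X)$ generated by $\varphi(S)$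 equals $GDNP_0(X)\cap Id[\varphi(S)]$; 3. there is an injective unital $k$-algebra homomorphism (with respect to $\cdot$) $\iota\colon GDNP(X|S)\to C(X|S)$ with $\iota(x)=x$ for $x\in X$ and $\iota(a\circ b)=\iota(a)\ast D\iota(b)$ for all $a,b$. Moreover, $C(X|S)$ with $\iota$ is the universal enveloping special GDN-Poisson admissible algebra of $GDNP(X|S)$: for every special GDN-Poisson admissible algebra $B$ and every homomorphism of GDN-Poisson algebras $f\colon GDNP(X|S)\to(B,\cdot,\circ)$ there is a unique homomorphism $g\colon C(X|S)\to B$ of special GDN-Poisson admissible algebras with $g\circ\iota=f$. Furthermore, every GDN-Poisson algebra over $k$ is isomorphic to $GDNP(X|S)$ for some set $X$ and some $S\subseteq GDNP(X)$. -/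

import Mathlib

universe u v w

/-! ## The two varieties of algebras

A commutative associative algebra with unit over `k` is a `CommRing` with an `Algebra k` structure;
the product is written `x * y` and the unit `1`. -/

/-- A (unital) GDN-Poisson algebra: a commutative associative unital algebra with a second bilinear
operation `circ` that is left symmetric and right commutative (so it is a Gelfand-Dorfman-Novikov
product) and satisfies the two compatibility conditions. -/
class GDNPoisson (k : Type u) (A : Type v) [Field k] [CommRing A] [Algebra k A] where
  circ : A →ₗ[k] A →ₗ[k] A
  left_symm : ∀ x y z : A,
    circ x (circ y z) - circ (circ x y) z = circ y (circ x z) - circ (circ y x) z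
  right_comm : ∀ x y z : A, circ (circ x y) z = circ (circ x z) y
  mul_circ : ∀ x y z : A, circ (x * y) z = x * circ y z
  circ_mul : ∀ x y z : A, circ x y * z - circ x (y * z) = circ y x * z - circ y (x * z)

/-- A special GDN-Poisson admissible algebra: a commutative associative unital algebra with a second
commutative associative bilinear operation `star` and a linear operation `D`. -/
class SpecialAdmissible (k : Type u) (A : Type v) [Field k] [CommRing A] [Algebra k A] where
  star : A →ₗ[k] A →ₗ[k] A
  D : A →ₗ[k] A
  star_comm : ∀ x y : A, star x y = star y x
  star_assoc : ∀ x y z : A, star (star x y) z = star x (star y z)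
  mul_star : ∀ x y z : A, star (x * y) z = x * star y z
  D_star : ∀ x y : A, D (star x y) = star (D x) y + star x (D y)
  D_mul : ∀ x y : A, D (x * y) = D x * y + x * D y - x * y * D 1

section Varieties

variable (k : Type u) [Field k] {A : Type v} [CommRing A] [Algebra k A]

/-- In a special GDN-Poisson admissible algebra the product `star` is a fixed multiple of the unital
product. -/
theorem SpecialAdmissible.exists_star_eq (A : Type v) [CommRing A] [Algebra k A]
    [SpecialAdmissible k A] :
    ∃ t : A, ∀ x y : A, SpecialAdmissible.star (k := k) x y = x * (y * t) := by
  refine ⟨SpecialAdmissible.star (k := k) (1 : A) 1, fun x y => ?_⟩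
  have h1 := SpecialAdmissible.mul_star (k := k) x 1 y
  have h2 := SpecialAdmissible.mul_star (k := k) y 1 (1 : A)
  have h3 := SpecialAdmissible.star_comm (k := k) (1 : A) y
  rw [mul_one] at h1 h2
  rw [h1, h3, h2]

/-- Every special GDN-Poisson admissible algebra is a GDN-Poisson algebra with respect to its unital
product and `x ∘ y = x ∗ D y`. -/
instance SpecialAdmissible.toGDNPoisson [SpecialAdmissible k A] : GDNPoisson k A where
  circ := (SpecialAdmissible.star (k := k) (A := A)).compl₂ (SpecialAdmissible.D (k := k))
  left_symm x y z := by
    simp only [LinearMap.compl₂_apply, SpecialAdmissible.D_star, map_add]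
    obtain ⟨t, ht⟩ := SpecialAdmissible.exists_star_eq k A
    simp only [ht]
    ring
  right_comm x y z := by
    simp only [LinearMap.compl₂_apply]
    obtain ⟨t, ht⟩ := SpecialAdmissible.exists_star_eq k A
    simp only [ht]
    ring
  mul_circ x y z := by
    simp only [LinearMap.compl₂_apply, SpecialAdmissible.mul_star]
  circ_mul x y z := by
    simp only [LinearMap.compl₂_apply, SpecialAdmissible.D_mul, map_add, map_sub]
    obtain ⟨t, ht⟩ := SpecialAdmissible.exists_star_eq k A
    simp only [ht]
    ring

/-- A homomorphism of GDN-Poisson algebras: a unital algebra homomorphism that preserves `circ`. -/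
def IsGDNPHom {B : Type w} [CommRing B] [Algebra k B] [GDNPoisson k A] [GDNPoisson k B]
    (f : A →ₐ[k] B) : Prop :=
  ∀ x y : A, f (GDNPoisson.circ (k := k) x y) = GDNPoisson.circ (k := k) (f x) (f y)

/-- A homomorphism of special GDN-Poisson admissible algebras: a unital algebra homomorphism that
preserves `star` and `D`. -/
def IsAdmissibleHom {B : Type w} [CommRing B] [Algebra k B]
    [SpecialAdmissible k A] [SpecialAdmissible k B] (f : A →ₐ[k] B) : Prop :=
  (∀ x y : A, f (SpecialAdmissible.star (k := k) x y) =
      SpecialAdmissible.star (k := k) (f x) (f y)) ∧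
    ∀ x : A, f (SpecialAdmissible.D (k := k) x) = SpecialAdmissible.D (k := k) (f x)

/-- Ideals of a GDN-Poisson algebra: ideals of the commutative ring that are also two-sided ideals
for `circ`. -/
def IsGDNPIdeal [GDNPoisson k A] (I : Ideal A) : Prop :=
  ∀ x ∈ I, ∀ y : A,
    GDNPoisson.circ (k := k) x y ∈ I ∧ GDNPoisson.circ (k := k) y x ∈ I

/-- The GDN-Poisson ideal `Id(S)` generated by a set `S`. -/
def gdnpIdeal [GDNPoisson k A] (S : Set A) : Ideal A :=
  sInf {I : Ideal A | S ⊆ I ∧ IsGDNPIdeal k I}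

/-- Ideals of a special GDN-Poisson admissible algebra: ideals of the commutative ring that are also
ideals for `star` and are stable under `D`. -/
def IsAdmissibleIdeal [SpecialAdmissible k A] (I : Ideal A) : Prop :=
  ∀ x ∈ I, (∀ y : A, SpecialAdmissible.star (k := k) x y ∈ I) ∧
    SpecialAdmissible.D (k := k) x ∈ I

/-- The ideal `Id[S]` of a special GDN-Poisson admissible algebra generated by a set `S`. -/
def admissibleIdeal [SpecialAdmissible k A] (S : Set A) : Ideal A :=
  sInf {I : Ideal A | S ⊆ I ∧ IsAdmissibleIdeal k I}

/-- For a GDN-Poisson subalgebra of `A` with underlying subspace `B`: the ideals of that subalgebra,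
as subspaces of `A` contained in `B`. -/
def IsGDNPIdealOf [GDNPoisson k A] (B J : Submodule k A) : Prop :=
  J ≤ B ∧ ∀ x ∈ J, ∀ b ∈ B,
    x * b ∈ J ∧ GDNPoisson.circ (k := k) x b ∈ J ∧ GDNPoisson.circ (k := k) b x ∈ J

/-- For a GDN-Poisson subalgebra of `A` with underlying subspace `B` and `S ⊆ B`: the ideal of that
subalgebra generated by `S`. -/
def gdnpIdealOf [GDNPoisson k A] (B : Submodule k A) (S : Set A) : Submodule k A :=
  sInf {J : Submodule k A | S ⊆ J ∧ IsGDNPIdealOf k B J}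

theorem isGDNPIdeal_gdnpIdeal [GDNPoisson k A] (S : Set A) :
    IsGDNPIdeal k (gdnpIdeal k S) := by
  intro x hx y
  simp only [gdnpIdeal, Submodule.mem_sInf] at hx ⊢
  exact ⟨fun I hI => (hI.2 x (hx I hI) y).1, fun I hI => (hI.2 x (hx I hI) y).2⟩

theorem isAdmissibleIdeal_admissibleIdeal [SpecialAdmissible k A] (S : Set A) :
    IsAdmissibleIdeal k (admissibleIdeal k S) := by
  intro x hx
  simp only [admissibleIdeal, Submodule.mem_sInf] at hx ⊢
  exact ⟨fun y I hI => (hI.2 x (hx I hI)).1 y, fun I hI => (hI.2 x (hx I hI)).2⟩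

variable {k}

/-- A bilinear operation descends to the quotient by a two-sided ideal for it. -/
def quotientBilin (I : Ideal A) (b : A →ₗ[k] A →ₗ[k] A)
    (hl : ∀ x ∈ I, ∀ y, b x y ∈ I) (hr : ∀ x ∈ I, ∀ y, b y x ∈ I) :
    (A ⧸ I) →ₗ[k] (A ⧸ I) →ₗ[k] (A ⧸ I) :=
  LinearMap.mk₂ k
    (Quotient.map₂ (fun x y => b x y) (by
      intro x x' hx y y' hy
      replace hx := (Submodule.quotientRel_def I).mp hx
      replace hy := (Submodule.quotientRel_def I).mp hy
      refine (Submodule.quotientRel_def I).mpr ?_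
      show b x y - b x' y' ∈ I
      have h : b x y - b x' y' = b (x - x') y + b x' (y - y') := by
        simp only [map_sub, LinearMap.sub_apply]; abel
      rw [h]
      exact I.add_mem (hl _ hx _) (hr _ hy _)))
    (by
      rintro ⟨x⟩ ⟨x'⟩ ⟨y⟩
      exact congrArg (Ideal.Quotient.mk I) (LinearMap.map_add₂ b x x' y))
    (by
      rintro c ⟨x⟩ ⟨y⟩
      exact congrArg (Ideal.Quotient.mk I) (LinearMap.map_smul₂ b c x y))
    (by
      rintro ⟨x⟩ ⟨y⟩ ⟨y'⟩
      exact congrArg (Ideal.Quotient.mk I) (map_add (b x) y y'))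
    (by
      rintro c ⟨x⟩ ⟨y⟩
      exact congrArg (Ideal.Quotient.mk I) (map_smul (b x) c y))

theorem quotientBilin_mk (I : Ideal A) (b : A →ₗ[k] A →ₗ[k] A)
    (hl : ∀ x ∈ I, ∀ y, b x y ∈ I) (hr : ∀ x ∈ I, ∀ y, b y x ∈ I) (x y : A) :
    quotientBilin I b hl hr (Ideal.Quotient.mk I x) (Ideal.Quotient.mk I y) =
      Ideal.Quotient.mk I (b x y) := rfl

/-- A linear operation descends to the quotient by a stable ideal. -/
def quotientLin (I : Ideal A) (d : A →ₗ[k] A) (h : ∀ x ∈ I, d x ∈ I) :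
    (A ⧸ I) →ₗ[k] (A ⧸ I) where
  toFun := Quotient.map (fun x => d x) (by
    intro x y hxy
    replace hxy := (Submodule.quotientRel_def I).mp hxy
    refine (Submodule.quotientRel_def I).mpr ?_
    show d x - d y ∈ I
    rw [← map_sub]
    exact h _ hxy)
  map_add' := by
    rintro ⟨x⟩ ⟨y⟩
    exact congrArg (Ideal.Quotient.mk I) (map_add d x y)
  map_smul' := by
    rintro c ⟨x⟩
    exact congrArg (Ideal.Quotient.mk I) (map_smul d c x)

theorem quotientLin_mk (I : Ideal A) (d : A →ₗ[k] A) (h : ∀ x ∈ I, d x ∈ I) (x : A) :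
    quotientLin I d h (Ideal.Quotient.mk I x) = Ideal.Quotient.mk I (d x) := rfl

/-- The quotient of a GDN-Poisson algebra by the ideal generated by `S`. -/
instance gdnpQuotient [GDNPoisson k A] (S : Set A) : GDNPoisson k (A ⧸ gdnpIdeal k S) where
  circ := quotientBilin (gdnpIdeal k S) GDNPoisson.circ
    (fun x hx y => (isGDNPIdeal_gdnpIdeal k S x hx y).1)
    (fun x hx y => (isGDNPIdeal_gdnpIdeal k S x hx y).2)
  left_symm := by
    rintro ⟨x⟩ ⟨y⟩ ⟨z⟩
    exact congrArg (Ideal.Quotient.mk _) (GDNPoisson.left_symm (k := k) x y z)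
  right_comm := by
    rintro ⟨x⟩ ⟨y⟩ ⟨z⟩
    exact congrArg (Ideal.Quotient.mk _) (GDNPoisson.right_comm (k := k) x y z)
  mul_circ := by
    rintro ⟨x⟩ ⟨y⟩ ⟨z⟩
    exact congrArg (Ideal.Quotient.mk _) (GDNPoisson.mul_circ (k := k) x y z)
  circ_mul := by
    rintro ⟨x⟩ ⟨y⟩ ⟨z⟩
    exact congrArg (Ideal.Quotient.mk _) (GDNPoisson.circ_mul (k := k) x y z)

/-- The quotient of a special GDN-Poisson admissible algebra by the ideal generated by `S`. -/
instance admissibleQuotient [SpecialAdmissible k A] (S : Set A) :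
    SpecialAdmissible k (A ⧸ admissibleIdeal k S) where
  star := quotientBilin (admissibleIdeal k S) SpecialAdmissible.star
    (fun x hx y => (isAdmissibleIdeal_admissibleIdeal k S x hx).1 y)
    (fun x hx y => by
      rw [SpecialAdmissible.star_comm]
      exact (isAdmissibleIdeal_admissibleIdeal k S x hx).1 y)
  D := quotientLin (admissibleIdeal k S) SpecialAdmissible.D
    (fun x hx => (isAdmissibleIdeal_admissibleIdeal k S x hx).2)
  star_comm := by
    rintro ⟨x⟩ ⟨y⟩
    exact congrArg (Ideal.Quotient.mk _) (SpecialAdmissible.star_comm (k := k) x y)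
  star_assoc := by
    rintro ⟨x⟩ ⟨y⟩ ⟨z⟩
    exact congrArg (Ideal.Quotient.mk _) (SpecialAdmissible.star_assoc (k := k) x y z)
  mul_star := by
    rintro ⟨x⟩ ⟨y⟩ ⟨z⟩
    exact congrArg (Ideal.Quotient.mk _) (SpecialAdmissible.mul_star (k := k) x y z)
  D_star := by
    rintro ⟨x⟩ ⟨y⟩
    exact congrArg (Ideal.Quotient.mk _) (SpecialAdmissible.D_star (k := k) x y)
  D_mul := by
    rintro ⟨x⟩ ⟨y⟩
    exact congrArg (Ideal.Quotient.mk _) (SpecialAdmissible.D_mul (k := k) x y)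

end Varieties

/-! ## The free GDN-Poisson algebra

It is the algebra of all terms in the operations, modulo the congruence generated by the axioms. The
term `scalar r` stands for `r • e`, where `e` is the unit. -/

inductive GDNPTerm (k : Type u) (X : Type v) : Type (max u v)
  | var : X → GDNPTerm k X
  | scalar : k → GDNPTerm k X
  | add : GDNPTerm k X → GDNPTerm k X → GDNPTerm k X
  | mul : GDNPTerm k X → GDNPTerm k X → GDNPTerm k X
  | circ : GDNPTerm k X → GDNPTerm k X → GDNPTerm k X

namespace GDNPTerm

/-- The axioms of GDN-Poisson algebras and the congruence rules. An equation `p - q = r - s` is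
written `p + s = r + q`. -/
inductive Rel (k : Type u) (X : Type v) [Field k] : GDNPTerm k X → GDNPTerm k X → Prop
  -- commutative associative unital algebra
  | scalar_add (r s : k) : Rel k X (scalar (r + s)) (add (scalar r) (scalar s))
  | scalar_mul (r s : k) : Rel k X (scalar (r * s)) (mul (scalar r) (scalar s))
  | add_comm (a b : GDNPTerm k X) : Rel k X (add a b) (add b a)
  | add_assoc (a b c : GDNPTerm k X) : Rel k X (add (add a b) c) (add a (add b c))
  | zero_mul (a : GDNPTerm k X) : Rel k X (mul (scalar 0) a) (scalar 0)
  | zero_add (a : GDNPTerm k X) : Rel k X (add (scalar 0) a) a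
  | mul_comm (a b : GDNPTerm k X) : Rel k X (mul a b) (mul b a)
  | mul_assoc (a b c : GDNPTerm k X) : Rel k X (mul (mul a b) c) (mul a (mul b c))
  | one_mul (a : GDNPTerm k X) : Rel k X (mul (scalar 1) a) a
  | mul_add (a b c : GDNPTerm k X) : Rel k X (mul a (add b c)) (add (mul a b) (mul a c))
  -- bilinearity of the second operation
  | add_circ (a b c : GDNPTerm k X) : Rel k X (circ (add a b) c) (add (circ a c) (circ b c))
  | circ_add (a b c : GDNPTerm k X) : Rel k X (circ a (add b c)) (add (circ a b) (circ a c))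
  | smul_circ (r : k) (a b : GDNPTerm k X) :
      Rel k X (circ (mul (scalar r) a) b) (mul (scalar r) (circ a b))
  | circ_smul (r : k) (a b : GDNPTerm k X) :
      Rel k X (circ a (mul (scalar r) b)) (mul (scalar r) (circ a b))
  -- the four identities
  | left_symm (a b c : GDNPTerm k X) :
      Rel k X (add (circ a (circ b c)) (circ (circ b a) c))
        (add (circ b (circ a c)) (circ (circ a b) c))
  | right_comm (a b c : GDNPTerm k X) : Rel k X (circ (circ a b) c) (circ (circ a c) b)
  | mul_circ (a b c : GDNPTerm k X) : Rel k X (circ (mul a b) c) (mul a (circ b c))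
  | circ_mul (a b c : GDNPTerm k X) :
      Rel k X (add (mul (circ a b) c) (circ b (mul a c)))
        (add (mul (circ b a) c) (circ a (mul b c)))
  -- congruence
  | congr_add_left (a b c : GDNPTerm k X) : Rel k X a b → Rel k X (add a c) (add b c)
  | congr_add_right (a b c : GDNPTerm k X) : Rel k X a b → Rel k X (add c a) (add c b)
  | congr_mul_left (a b c : GDNPTerm k X) : Rel k X a b → Rel k X (mul a c) (mul b c)
  | congr_mul_right (a b c : GDNPTerm k X) : Rel k X a b → Rel k X (mul c a) (mul c b)
  | congr_circ_left (a b c : GDNPTerm k X) : Rel k X a b → Rel k X (circ a c) (circ b c)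
  | congr_circ_right (a b c : GDNPTerm k X) : Rel k X a b → Rel k X (circ c a) (circ c b)

end GDNPTerm

/-- The free GDN-Poisson algebra `GDNP(X)` over `k`. -/
def FreeGDNP (k : Type u) (X : Type v) [Field k] : Type (max u v) := Quot (GDNPTerm.Rel k X)

namespace FreeGDNP

open GDNPTerm

variable {k : Type u} {X : Type v} [Field k]

/-- The class of a term. -/
def mk (a : GDNPTerm k X) : FreeGDNP k X := Quot.mk _ a

instance : Add (FreeGDNP k X) where
  add := Quot.map₂ add (fun c a b => Rel.congr_add_right a b c) (fun a b c => Rel.congr_add_left a b c)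

instance : Zero (FreeGDNP k X) where
  zero := mk (scalar 0)

instance : Neg (FreeGDNP k X) where
  neg := Quot.map (fun a => mul (scalar (-1)) a) (fun a b => Rel.congr_mul_right a b _)

instance : CommRing (FreeGDNP k X) where
  mul := Quot.map₂ mul (fun c a b => Rel.congr_mul_right a b c) (fun a b c => Rel.congr_mul_left a b c)
  one := mk (scalar 1)
  nsmul := nsmulRec
  zsmul := zsmulRec
  add_assoc := by rintro ⟨a⟩ ⟨b⟩ ⟨c⟩; exact Quot.sound (Rel.add_assoc a b c)
  add_comm := by rintro ⟨a⟩ ⟨b⟩; exact Quot.sound (Rel.add_comm a b)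
  zero_add := by rintro ⟨a⟩; exact Quot.sound (Rel.zero_add a)
  add_zero := by
    rintro ⟨a⟩
    exact (Quot.sound (Rel.add_comm a _)).trans (Quot.sound (Rel.zero_add a))
  mul_assoc := by rintro ⟨a⟩ ⟨b⟩ ⟨c⟩; exact Quot.sound (Rel.mul_assoc a b c)
  mul_comm := by rintro ⟨a⟩ ⟨b⟩; exact Quot.sound (Rel.mul_comm a b)
  one_mul := by rintro ⟨a⟩; exact Quot.sound (Rel.one_mul a)
  mul_one := by
    rintro ⟨a⟩
    exact (Quot.sound (Rel.mul_comm a _)).trans (Quot.sound (Rel.one_mul a))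
  zero_mul := by rintro ⟨a⟩; exact Quot.sound (Rel.zero_mul a)
  mul_zero := by
    rintro ⟨a⟩
    exact (Quot.sound (Rel.mul_comm a _)).trans (Quot.sound (Rel.zero_mul a))
  left_distrib := by rintro ⟨a⟩ ⟨b⟩ ⟨c⟩; exact Quot.sound (Rel.mul_add a b c)
  right_distrib := by
    rintro ⟨a⟩ ⟨b⟩ ⟨c⟩
    refine (Quot.sound (Rel.mul_comm _ c)).trans ((Quot.sound (Rel.mul_add c a b)).trans ?_)
    exact (Quot.sound (Rel.congr_add_left _ _ _ (Rel.mul_comm c a))).trans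
      (Quot.sound (Rel.congr_add_right _ _ _ (Rel.mul_comm c b)))
  neg_add_cancel := by
    rintro ⟨a⟩
    have h1 : (mk (mul a (add (scalar (-1)) (scalar 1))) : FreeGDNP k X) = mk (scalar 0) := by
      refine (Quot.sound (Rel.congr_mul_right _ _ a (Rel.scalar_add (-1) 1))).symm.trans ?_
      rw [neg_add_cancel]
      exact (Quot.sound (Rel.mul_comm a _)).trans (Quot.sound (Rel.zero_mul a))
    refine Eq.trans ?_ h1
    symm
    refine (Quot.sound (Rel.mul_add a _ _)).trans ?_
    refine (Quot.sound (Rel.congr_add_left _ _ _ (Rel.mul_comm a _))).trans ?_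
    exact Quot.sound (Rel.congr_add_right _ _ _
      (Rel.mul_comm a (scalar 1))) |>.trans
      (Quot.sound (Rel.congr_add_right _ _ _ (Rel.one_mul a)))

instance : Algebra k (FreeGDNP k X) :=
  RingHom.toAlgebra
    { toFun := fun r => mk (scalar r)
      map_one' := rfl
      map_zero' := rfl
      map_add' := fun r s => Quot.sound (Rel.scalar_add r s)
      map_mul' := fun r s => Quot.sound (Rel.scalar_mul r s) }

instance : GDNPoisson k (FreeGDNP k X) where
  circ := LinearMap.mk₂ k
    (Quot.map₂ GDNPTerm.circ (fun c a b => Rel.congr_circ_right a b c)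
      (fun a b c => Rel.congr_circ_left a b c))
    (by rintro ⟨a⟩ ⟨b⟩ ⟨c⟩; exact Quot.sound (Rel.add_circ a b c))
    (by rintro r ⟨a⟩ ⟨b⟩; exact Quot.sound (Rel.smul_circ r a b))
    (by rintro ⟨a⟩ ⟨b⟩ ⟨c⟩; exact Quot.sound (Rel.circ_add a b c))
    (by rintro r ⟨a⟩ ⟨b⟩; exact Quot.sound (Rel.circ_smul r a b))
  left_symm := by
    rintro ⟨a⟩ ⟨b⟩ ⟨c⟩
    exact sub_eq_sub_iff_add_eq_add.mpr (Quot.sound (Rel.left_symm a b c))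
  right_comm := by rintro ⟨a⟩ ⟨b⟩ ⟨c⟩; exact Quot.sound (Rel.right_comm a b c)
  mul_circ := by rintro ⟨a⟩ ⟨b⟩ ⟨c⟩; exact Quot.sound (Rel.mul_circ a b c)
  circ_mul := by
    rintro ⟨a⟩ ⟨b⟩ ⟨c⟩
    exact sub_eq_sub_iff_add_eq_add.mpr (Quot.sound (Rel.circ_mul a b c))

/-- The generator `x` of `GDNP(X)`. -/
def of (x : X) : FreeGDNP k X := mk (var x)

section Lift

variable {A : Type w} [CommRing A] [Algebra k A] [GDNPoisson k A]

/-- The value of a term in a GDN-Poisson algebra. -/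
def eval (f : X → A) : GDNPTerm k X → A
  | var x => f x
  | scalar r => algebraMap k A r
  | add a b => eval f a + eval f b
  | mul a b => eval f a * eval f b
  | GDNPTerm.circ a b => GDNPoisson.circ (k := k) (eval f a) (eval f b)

theorem eval_rel (f : X → A) {a b : GDNPTerm k X} (h : Rel k X a b) : eval f a = eval f b := by
  induction h with
  | scalar_add r s => simp [eval]
  | scalar_mul r s => simp [eval]
  | add_comm a b => simp only [eval]; ring
  | add_assoc a b c => simp only [eval]; ring
  | zero_mul a => simp [eval]
  | zero_add a => simp [eval]
  | mul_comm a b => simp only [eval]; ring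
  | mul_assoc a b c => simp only [eval]; ring
  | one_mul a => simp [eval]
  | mul_add a b c => simp only [eval]; ring
  | add_circ a b c => simp [eval]
  | circ_add a b c => simp [eval]
  | smul_circ r a b => simp [eval, ← Algebra.smul_def]
  | circ_smul r a b => simp [eval, ← Algebra.smul_def]
  | left_symm a b c =>
    exact sub_eq_sub_iff_add_eq_add.mp (GDNPoisson.left_symm (k := k) _ _ _)
  | right_comm a b c => exact GDNPoisson.right_comm (k := k) _ _ _
  | mul_circ a b c => exact GDNPoisson.mul_circ (k := k) _ _ _
  | circ_mul a b c =>
    exact sub_eq_sub_iff_add_eq_add.mp (GDNPoisson.circ_mul (k := k) _ _ _)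
  | congr_add_left a b c _ ih => simp only [eval, ih]
  | congr_add_right a b c _ ih => simp only [eval, ih]
  | congr_mul_left a b c _ ih => simp only [eval, ih]
  | congr_mul_right a b c _ ih => simp only [eval, ih]
  | congr_circ_left a b c _ ih => simp only [eval, ih]
  | congr_circ_right a b c _ ih => simp only [eval, ih]

/-- The homomorphism from the free GDN-Poisson algebra that is induced by a map on generators. -/
def lift (f : X → A) : FreeGDNP k X →ₐ[k] A where
  toFun := Quot.lift (eval f) (fun _ _ h => eval_rel f h)
  map_one' := map_one (algebraMap k A)
  map_zero' := map_zero (algebraMap k A)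
  map_mul' := by rintro ⟨a⟩ ⟨b⟩; rfl
  map_add' := by rintro ⟨a⟩ ⟨b⟩; rfl
  commutes' _ := rfl

theorem lift_of (f : X → A) (x : X) : lift (k := k) f (of x) = f x := rfl

theorem isGDNPHom_lift (f : X → A) : IsGDNPHom k (lift (k := k) f) := by
  rintro ⟨a⟩ ⟨b⟩; rfl

end Lift

end FreeGDNP

/-! ## The free special GDN-Poisson admissible algebra -/

inductive AdmissibleTerm (k : Type u) (X : Type v) : Type (max u v)
  | var : X → AdmissibleTerm k X
  | scalar : k → AdmissibleTerm k X
  | add : AdmissibleTerm k X → AdmissibleTerm k X → AdmissibleTerm k X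
  | mul : AdmissibleTerm k X → AdmissibleTerm k X → AdmissibleTerm k X
  | star : AdmissibleTerm k X → AdmissibleTerm k X → AdmissibleTerm k X
  | D : AdmissibleTerm k X → AdmissibleTerm k X

namespace AdmissibleTerm

/-- The axioms of special GDN-Poisson admissible algebras and the congruence rules. An equation
`p = q + r - s` is written `p + s = q + r`. -/
inductive Rel (k : Type u) (X : Type v) [Field k] :
    AdmissibleTerm k X → AdmissibleTerm k X → Prop
  -- commutative associative unital algebra
  | scalar_add (r s : k) : Rel k X (scalar (r + s)) (add (scalar r) (scalar s))
  | scalar_mul (r s : k) : Rel k X (scalar (r * s)) (mul (scalar r) (scalar s))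
  | add_comm (a b : AdmissibleTerm k X) : Rel k X (add a b) (add b a)
  | add_assoc (a b c : AdmissibleTerm k X) : Rel k X (add (add a b) c) (add a (add b c))
  | zero_mul (a : AdmissibleTerm k X) : Rel k X (mul (scalar 0) a) (scalar 0)
  | zero_add (a : AdmissibleTerm k X) : Rel k X (add (scalar 0) a) a
  | mul_comm (a b : AdmissibleTerm k X) : Rel k X (mul a b) (mul b a)
  | mul_assoc (a b c : AdmissibleTerm k X) : Rel k X (mul (mul a b) c) (mul a (mul b c))
  | one_mul (a : AdmissibleTerm k X) : Rel k X (mul (scalar 1) a) a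
  | mul_add (a b c : AdmissibleTerm k X) : Rel k X (mul a (add b c)) (add (mul a b) (mul a c))
  -- bilinearity of `star` and linearity of `D`
  | add_star (a b c : AdmissibleTerm k X) : Rel k X (star (add a b) c) (add (star a c) (star b c))
  | star_add (a b c : AdmissibleTerm k X) : Rel k X (star a (add b c)) (add (star a b) (star a c))
  | smul_star (r : k) (a b : AdmissibleTerm k X) :
      Rel k X (star (mul (scalar r) a) b) (mul (scalar r) (star a b))
  | star_smul (r : k) (a b : AdmissibleTerm k X) :
      Rel k X (star a (mul (scalar r) b)) (mul (scalar r) (star a b))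
  | D_add (a b : AdmissibleTerm k X) : Rel k X (D (add a b)) (add (D a) (D b))
  | D_smul (r : k) (a : AdmissibleTerm k X) :
      Rel k X (D (mul (scalar r) a)) (mul (scalar r) (D a))
  -- the identities
  | star_comm (a b : AdmissibleTerm k X) : Rel k X (star a b) (star b a)
  | star_assoc (a b c : AdmissibleTerm k X) : Rel k X (star (star a b) c) (star a (star b c))
  | mul_star (a b c : AdmissibleTerm k X) : Rel k X (star (mul a b) c) (mul a (star b c))
  | D_star (a b : AdmissibleTerm k X) :
      Rel k X (D (star a b)) (add (star (D a) b) (star a (D b)))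
  | D_mul (a b : AdmissibleTerm k X) :
      Rel k X (add (D (mul a b)) (mul (mul a b) (D (scalar 1))))
        (add (mul (D a) b) (mul a (D b)))
  -- congruence
  | congr_add_left (a b c : AdmissibleTerm k X) : Rel k X a b → Rel k X (add a c) (add b c)
  | congr_add_right (a b c : AdmissibleTerm k X) : Rel k X a b → Rel k X (add c a) (add c b)
  | congr_mul_left (a b c : AdmissibleTerm k X) : Rel k X a b → Rel k X (mul a c) (mul b c)
  | congr_mul_right (a b c : AdmissibleTerm k X) : Rel k X a b → Rel k X (mul c a) (mul c b)
  | congr_star_left (a b c : AdmissibleTerm k X) : Rel k X a b → Rel k X (star a c) (star b c)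
  | congr_star_right (a b c : AdmissibleTerm k X) : Rel k X a b → Rel k X (star c a) (star c b)
  | congr_D (a b : AdmissibleTerm k X) : Rel k X a b → Rel k X (D a) (D b)

end AdmissibleTerm

/-- The free special GDN-Poisson admissible algebra `C(X)` over `k`. -/
def FreeAdmissible (k : Type u) (X : Type v) [Field k] : Type (max u v) :=
  Quot (AdmissibleTerm.Rel k X)

namespace FreeAdmissible

open AdmissibleTerm

variable {k : Type u} {X : Type v} [Field k]

/-- The class of a term. -/
def mk (a : AdmissibleTerm k X) : FreeAdmissible k X := Quot.mk _ a

instance : Add (FreeAdmissible k X) where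
  add := Quot.map₂ add (fun c a b => Rel.congr_add_right a b c) (fun a b c => Rel.congr_add_left a b c)

instance : Zero (FreeAdmissible k X) where
  zero := mk (scalar 0)

instance : Neg (FreeAdmissible k X) where
  neg := Quot.map (fun a => mul (scalar (-1)) a) (fun a b => Rel.congr_mul_right a b _)

instance : CommRing (FreeAdmissible k X) where
  mul := Quot.map₂ mul (fun c a b => Rel.congr_mul_right a b c) (fun a b c => Rel.congr_mul_left a b c)
  one := mk (scalar 1)
  nsmul := nsmulRec
  zsmul := zsmulRec
  add_assoc := by rintro ⟨a⟩ ⟨b⟩ ⟨c⟩; exact Quot.sound (Rel.add_assoc a b c)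
  add_comm := by rintro ⟨a⟩ ⟨b⟩; exact Quot.sound (Rel.add_comm a b)
  zero_add := by rintro ⟨a⟩; exact Quot.sound (Rel.zero_add a)
  add_zero := by
    rintro ⟨a⟩
    exact (Quot.sound (Rel.add_comm a _)).trans (Quot.sound (Rel.zero_add a))
  mul_assoc := by rintro ⟨a⟩ ⟨b⟩ ⟨c⟩; exact Quot.sound (Rel.mul_assoc a b c)
  mul_comm := by rintro ⟨a⟩ ⟨b⟩; exact Quot.sound (Rel.mul_comm a b)
  one_mul := by rintro ⟨a⟩; exact Quot.sound (Rel.one_mul a)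
  mul_one := by
    rintro ⟨a⟩
    exact (Quot.sound (Rel.mul_comm a _)).trans (Quot.sound (Rel.one_mul a))
  zero_mul := by rintro ⟨a⟩; exact Quot.sound (Rel.zero_mul a)
  mul_zero := by
    rintro ⟨a⟩
    exact (Quot.sound (Rel.mul_comm a _)).trans (Quot.sound (Rel.zero_mul a))
  left_distrib := by rintro ⟨a⟩ ⟨b⟩ ⟨c⟩; exact Quot.sound (Rel.mul_add a b c)
  right_distrib := by
    rintro ⟨a⟩ ⟨b⟩ ⟨c⟩
    refine (Quot.sound (Rel.mul_comm _ c)).trans ((Quot.sound (Rel.mul_add c a b)).trans ?_)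
    exact (Quot.sound (Rel.congr_add_left _ _ _ (Rel.mul_comm c a))).trans
      (Quot.sound (Rel.congr_add_right _ _ _ (Rel.mul_comm c b)))
  neg_add_cancel := by
    rintro ⟨a⟩
    have h1 : (mk (mul a (add (scalar (-1)) (scalar 1))) : FreeAdmissible k X) = mk (scalar 0) := by
      refine (Quot.sound (Rel.congr_mul_right _ _ a (Rel.scalar_add (-1) 1))).symm.trans ?_
      rw [neg_add_cancel]
      exact (Quot.sound (Rel.mul_comm a _)).trans (Quot.sound (Rel.zero_mul a))
    refine Eq.trans ?_ h1
    symm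
    refine (Quot.sound (Rel.mul_add a _ _)).trans ?_
    refine (Quot.sound (Rel.congr_add_left _ _ _ (Rel.mul_comm a _))).trans ?_
    exact Quot.sound (Rel.congr_add_right _ _ _
      (Rel.mul_comm a (scalar 1))) |>.trans
      (Quot.sound (Rel.congr_add_right _ _ _ (Rel.one_mul a)))

instance : Algebra k (FreeAdmissible k X) :=
  RingHom.toAlgebra
    { toFun := fun r => mk (scalar r)
      map_one' := rfl
      map_zero' := rfl
      map_add' := fun r s => Quot.sound (Rel.scalar_add r s)
      map_mul' := fun r s => Quot.sound (Rel.scalar_mul r s) }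

instance : SpecialAdmissible k (FreeAdmissible k X) where
  star := LinearMap.mk₂ k
    (Quot.map₂ AdmissibleTerm.star (fun c a b => Rel.congr_star_right a b c)
      (fun a b c => Rel.congr_star_left a b c))
    (by rintro ⟨a⟩ ⟨b⟩ ⟨c⟩; exact Quot.sound (Rel.add_star a b c))
    (by rintro r ⟨a⟩ ⟨b⟩; exact Quot.sound (Rel.smul_star r a b))
    (by rintro ⟨a⟩ ⟨b⟩ ⟨c⟩; exact Quot.sound (Rel.star_add a b c))
    (by rintro r ⟨a⟩ ⟨b⟩; exact Quot.sound (Rel.star_smul r a b))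
  D :=
    { toFun := Quot.map AdmissibleTerm.D (fun a b => Rel.congr_D a b)
      map_add' := by rintro ⟨a⟩ ⟨b⟩; exact Quot.sound (Rel.D_add a b)
      map_smul' := by rintro r ⟨a⟩; exact Quot.sound (Rel.D_smul r a) }
  star_comm := by rintro ⟨a⟩ ⟨b⟩; exact Quot.sound (Rel.star_comm a b)
  star_assoc := by rintro ⟨a⟩ ⟨b⟩ ⟨c⟩; exact Quot.sound (Rel.star_assoc a b c)
  mul_star := by rintro ⟨a⟩ ⟨b⟩ ⟨c⟩; exact Quot.sound (Rel.mul_star a b c)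
  D_star := by rintro ⟨a⟩ ⟨b⟩; exact Quot.sound (Rel.D_star a b)
  D_mul := by
    rintro ⟨a⟩ ⟨b⟩
    exact eq_sub_iff_add_eq.mpr (Quot.sound (Rel.D_mul a b))

/-- The generator `x` of `C(X)`. -/
def of (x : X) : FreeAdmissible k X := mk (var x)

end FreeAdmissible

/-! ## Words and weights in `C(X)` -/

/-- A letter `D^i a` with `a` in `X ∪ {e}`; here `none` stands for the unit `e`. -/
abbrev DLetter (X : Type v) : Type v := ℕ × Option X

/-- A word `D^{i₁}a₁ ∗ ⋯ ∗ D^{iⱼ}aⱼ · D^{iⱼ₊₁}aⱼ₊₁ ⋯ D^{iₙ}aₙ`, with `n ≥ j ≥ 1`: `head` and `stars`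
hold the first `j` letters, `dots` the other ones. If `j < n`, no letter is `D^0 e = e`. The letters
are in any order: the element of `C(X)` that a word represents does not depend on it. Words
with letters in weakly decreasing order (for a well-order of `X` and `e < x`) are normal forms. -/
structure AdmissibleWord (X : Type v) where
  head : DLetter X
  stars : List (DLetter X)
  dots : List (DLetter X)
  ne_unit : dots ≠ [] → ∀ l ∈ head :: stars ++ dots, l ≠ (0, none)

namespace AdmissibleWord

variable (k : Type u) {X : Type v} [Field k]

/-- The element `D^i a` of `C(X)`. -/
def letterVal : DLetter X → FreeAdmissible k X
  | (i, none) => (SpecialAdmissible.D (k := k) (A := FreeAdmissible k X))^[i] 1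
  | (i, some x) => (SpecialAdmissible.D (k := k) (A := FreeAdmissible k X))^[i] (FreeAdmissible.of x)

/-- The element of `C(X)` that a word represents (left-normed bracketing). -/
def val (w : AdmissibleWord X) : FreeAdmissible k X :=
  w.dots.foldl (fun f l => f * letterVal k l)
    (w.stars.foldl (fun f l => SpecialAdmissible.star (k := k) f (letterVal k l))
      (letterVal k w.head))

/-- The weight of a word: the total number of `D` minus the number of `∗`. -/
def wt (w : AdmissibleWord X) : ℤ :=
  ((w.head :: w.stars ++ w.dots).map (fun l => (l.1 : ℤ))).sum - (w.stars.length : ℤ)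

end AdmissibleWord

section Presentations

variable (k : Type u) (X : Type v) [Field k]

/-- `GDNP₀(X)`: the subspace of `C(X)` spanned by the words of weight `0`. -/
def gdnpZero : Submodule k (FreeAdmissible k X) :=
  Submodule.span k {f | ∃ w : AdmissibleWord X, w.wt = 0 ∧ w.val k = f}

/-- The homomorphism `GDNP(X) → C(X)` of GDN-Poisson algebras that is the identity on `X`. -/
def gdnpToAdmissible : FreeGDNP k X →ₐ[k] FreeAdmissible k X :=
  FreeGDNP.lift FreeAdmissible.of

variable {X}

/-- `GDNP(X|S)`: the GDN-Poisson algebra generated by `X` with defining relations `S`. -/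
abbrev PresentedGDNP (S : Set (FreeGDNP k X)) : Type (max u v) :=
  FreeGDNP k X ⧸ gdnpIdeal k S

/-- `C(X|S)`: the special GDN-Poisson admissible algebra generated by `X` with defining
relations `S`. Relations in `GDNP(X)` are read in `C(X)`, through `x ∘ y = x ∗ D y`. -/
abbrev PresentedAdmissible (S : Set (FreeGDNP k X)) : Type (max u v) :=
  FreeAdmissible k X ⧸ admissibleIdeal k (gdnpToAdmissible k X '' S)

end Presentations

/-! ### Both kinds of algebra as a commutative algebra with one operator -/

section Operators

variable (k : Type u) [Field k]

/-! Write d(x) = e ∘ x and t = e ∗ e. A GDN-Poisson product is x ∘ y = x·d(y), and an admissible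
star product is x ∗ y = x·y·t. The operators d and D satisfy the same Leibniz rule, corrected by
their value at e, and the Leibniz rule for ∗ amounts to D t = 2 t (D e).

Hence every GDN-Poisson algebra A embeds into an admissible one: take `A[T;T⁻¹]` with t = T and D(a
Tⁿ) = (d(a) + n a d(e)) Tⁿ⁻¹. The operator lowers the degree by one and ∗ raises it by one, so the
constants keep their own product ∘ (`laurentAdmissible`, `isGDNPHom_laurentC`). This replaces any
computation of normal forms in C(X). With A = GDNP(X) it makes φ injective. With A = GDNP(X|S), the
induced map from C(X) kills Id[φ(S)], so φ(a) ∈ Id[φ(S)] forces a ∈ Id(S)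
(`gdnpToAdmissible_mem_admissibleIdeal_iff`). The statement on ideals and the injectivity of ι
follow.

For the image of φ, a word with s stars equals tˢ times the product of its letters. Weight 0 says
that s is the number of D's, so the word is a product of balanced letters b_i = tⁱ Dⁱ a, and
GDNP₀(X) is the subalgebra that these generate (`gdnpZero_eq_adjoin`). The recurrence b_{i+1} = e ∘
b_i - i (e ∘ e) b_i (`balancedLetter_succ`) shows that this subalgebra is closed under ∘ and is
reached from X and e. -/

theorem GDNPoisson.circ_eq_mul {A : Type v} [CommRing A] [Algebra k A] [GDNPoisson k A] (x y : A) :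
    GDNPoisson.circ (k := k) x y = x * GDNPoisson.circ (k := k) 1 y := by
  rw [← GDNPoisson.mul_circ, mul_one]

/-- This is `circ_mul` with first argument e, once each x ∘ z is written as x·(e ∘ z). It has the
same shape as `D_mul`. -/
theorem GDNPoisson.one_circ_mul {A : Type v} [CommRing A] [Algebra k A] [GDNPoisson k A]
    (x y : A) :
    GDNPoisson.circ (k := k) 1 (x * y) =
      GDNPoisson.circ (k := k) 1 x * y + x * GDNPoisson.circ (k := k) 1 y -
        x * y * GDNPoisson.circ (k := k) (1 : A) 1 := by
  have h := GDNPoisson.circ_mul (k := k) 1 x y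
  rw [GDNPoisson.circ_eq_mul k x 1, GDNPoisson.circ_eq_mul k x (1 * y), one_mul] at h
  linear_combination -h

/-- `mul_star` extracts the left factor, and commutativity brings the right factor to the left. The
whole operation ∗ is thus encoded in the single element t = e ∗ e. -/
theorem SpecialAdmissible.star_eq_mul {A : Type v} [CommRing A] [Algebra k A]
    [SpecialAdmissible k A] (x y : A) :
    SpecialAdmissible.star (k := k) x y = x * y * SpecialAdmissible.star (k := k) (1 : A) 1 := by
  have h1 := SpecialAdmissible.mul_star (k := k) x 1 y
  have h2 := SpecialAdmissible.mul_star (k := k) y 1 (1 : A)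
  rw [mul_one] at h1 h2
  rw [h1, SpecialAdmissible.star_comm, h2, mul_assoc]

theorem SpecialAdmissible.circ_def {A : Type v} [CommRing A] [Algebra k A]
    [SpecialAdmissible k A] (x y : A) :
    GDNPoisson.circ (k := k) x y =
      SpecialAdmissible.star (k := k) x (SpecialAdmissible.D (k := k) y) := rfl

/-- With `t = e ∗ e`, one has `D t = 2 t (D e)`. -/
theorem SpecialAdmissible.D_star_one_one {A : Type v} [CommRing A] [Algebra k A]
    [SpecialAdmissible k A] :
    SpecialAdmissible.D (k := k) (SpecialAdmissible.star (k := k) (1 : A) 1) =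
      2 * SpecialAdmissible.star (k := k) (1 : A) 1 * SpecialAdmissible.D (k := k) (1 : A) := by
  rw [SpecialAdmissible.D_star, SpecialAdmissible.star_eq_mul k (SpecialAdmissible.D (k := k) 1),
    SpecialAdmissible.star_eq_mul k 1 (SpecialAdmissible.D (k := k) (1 : A))]
  ring

theorem IsAdmissibleHom.isGDNPHom {k : Type u} [Field k] {A : Type v} {B : Type w} [CommRing A]
    [Algebra k A] [CommRing B] [Algebra k B] [SpecialAdmissible k A] [SpecialAdmissible k B]
    {f : A →ₐ[k] B} (hf : IsAdmissibleHom k f) : IsGDNPHom k f := fun x y => by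
  rw [SpecialAdmissible.circ_def, SpecialAdmissible.circ_def, hf.1, hf.2]

theorem IsGDNPHom.comp {k : Type u} [Field k] {A B C : Type*} [CommRing A] [Algebra k A]
    [CommRing B] [Algebra k B] [CommRing C] [Algebra k C] [GDNPoisson k A] [GDNPoisson k B]
    [GDNPoisson k C] {g : B →ₐ[k] C} {f : A →ₐ[k] B} (hg : IsGDNPHom k g) (hf : IsGDNPHom k f) :
    IsGDNPHom k (g.comp f) := fun x y => by
  rw [AlgHom.comp_apply, hf, hg, AlgHom.comp_apply, AlgHom.comp_apply]

end Operators

/-! ## Generated ideals and quotients -/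

section Ideals

variable {k : Type u} [Field k]

section GDNP

variable {A : Type v} [CommRing A] [Algebra k A] [GDNPoisson k A]

theorem subset_gdnpIdeal (S : Set A) : S ⊆ gdnpIdeal k S := fun s hs => by
  rw [gdnpIdeal, SetLike.mem_coe, Submodule.mem_sInf]
  exact fun I hI => hI.1 hs

theorem gdnpIdeal_le {S : Set A} {I : Ideal A} (hS : S ⊆ I) (hI : IsGDNPIdeal k I) :
    gdnpIdeal k S ≤ I := sInf_le ⟨hS, hI⟩

theorem IsGDNPHom.isGDNPIdeal_ker {B : Type w} [CommRing B] [Algebra k B] [GDNPoisson k B]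
    {f : A →ₐ[k] B} (hf : IsGDNPHom k f) : IsGDNPIdeal k (RingHom.ker f) := fun x hx y => by
  rw [RingHom.mem_ker] at hx
  simp only [RingHom.mem_ker, hf x y, hf y x, hx, map_zero, LinearMap.zero_apply, and_self]

theorem isGDNPHom_mk (S : Set A) : IsGDNPHom k (Ideal.Quotient.mkₐ k (gdnpIdeal k S)) :=
  fun _ _ => rfl

end GDNP

section Admissible

variable {A : Type v} [CommRing A] [Algebra k A] [SpecialAdmissible k A]

theorem subset_admissibleIdeal (S : Set A) : S ⊆ admissibleIdeal k S := fun s hs => by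
  rw [admissibleIdeal, SetLike.mem_coe, Submodule.mem_sInf]
  exact fun I hI => hI.1 hs

theorem admissibleIdeal_le {S : Set A} {I : Ideal A} (hS : S ⊆ I) (hI : IsAdmissibleIdeal k I) :
    admissibleIdeal k S ≤ I := sInf_le ⟨hS, hI⟩

theorem IsAdmissibleHom.isAdmissibleIdeal_ker {B : Type w} [CommRing B] [Algebra k B]
    [SpecialAdmissible k B] {f : A →ₐ[k] B} (hf : IsAdmissibleHom k f) :
    IsAdmissibleIdeal k (RingHom.ker f) := fun x hx => by
  rw [RingHom.mem_ker] at hx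
  simp [RingHom.mem_ker, hf.1, hf.2, hx]

theorem isAdmissibleHom_mk (S : Set A) :
    IsAdmissibleHom k (Ideal.Quotient.mkₐ k (admissibleIdeal k S)) :=
  ⟨fun _ _ => rfl, fun _ => rfl⟩

end Admissible

end Ideals

/-! ## Universal property of `C(X)` -/

namespace FreeAdmissible

open AdmissibleTerm

variable {k : Type u} {X : Type v} [Field k] {B : Type w} [CommRing B] [Algebra k B]
  [SpecialAdmissible k B]

/-- The value of a term in a special GDN-Poisson admissible algebra. -/
def eval (f : X → B) : AdmissibleTerm k X → B
  | var x => f x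
  | scalar r => algebraMap k B r
  | add a b => eval f a + eval f b
  | mul a b => eval f a * eval f b
  | AdmissibleTerm.star a b => SpecialAdmissible.star (k := k) (eval f a) (eval f b)
  | AdmissibleTerm.D a => SpecialAdmissible.D (k := k) (eval f a)

theorem eval_rel (f : X → B) {a b : AdmissibleTerm k X} (h : Rel k X a b) :
    eval f a = eval f b := by
  induction h with
  | scalar_add r s => simp [eval]
  | scalar_mul r s => simp [eval]
  | add_comm a b => simp only [eval]; ring
  | add_assoc a b c => simp only [eval]; ring
  | zero_mul a => simp [eval]
  | zero_add a => simp [eval]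
  | mul_comm a b => simp only [eval]; ring
  | mul_assoc a b c => simp only [eval]; ring
  | one_mul a => simp [eval]
  | mul_add a b c => simp only [eval]; ring
  | add_star a b c => simp [eval]
  | star_add a b c => simp [eval]
  | smul_star r a b => simp [eval, ← Algebra.smul_def]
  | star_smul r a b => simp [eval, ← Algebra.smul_def]
  | D_add a b => simp [eval]
  | D_smul r a => simp [eval, ← Algebra.smul_def]
  | star_comm a b => exact SpecialAdmissible.star_comm (k := k) _ _
  | star_assoc a b c => exact SpecialAdmissible.star_assoc (k := k) _ _ _
  | mul_star a b c => exact SpecialAdmissible.mul_star (k := k) _ _ _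
  | D_star a b => exact SpecialAdmissible.D_star (k := k) _ _
  | D_mul a b => simp only [eval, SpecialAdmissible.D_mul, map_one]; ring
  | congr_add_left a b c _ ih => simp only [eval, ih]
  | congr_add_right a b c _ ih => simp only [eval, ih]
  | congr_mul_left a b c _ ih => simp only [eval, ih]
  | congr_mul_right a b c _ ih => simp only [eval, ih]
  | congr_star_left a b c _ ih => simp only [eval, ih]
  | congr_star_right a b c _ ih => simp only [eval, ih]
  | congr_D a b _ ih => simp only [eval, ih]

/-- The homomorphism from `C(X)` that is induced by a map on generators. -/
def lift (f : X → B) : FreeAdmissible k X →ₐ[k] B where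
  toFun := Quot.lift (eval f) (fun _ _ h => eval_rel f h)
  map_one' := map_one (algebraMap k B)
  map_zero' := map_zero (algebraMap k B)
  map_mul' := by rintro ⟨a⟩ ⟨b⟩; rfl
  map_add' := by rintro ⟨a⟩ ⟨b⟩; rfl
  commutes' _ := rfl

theorem isAdmissibleHom_lift (f : X → B) : IsAdmissibleHom k (lift (k := k) f) :=
  ⟨by rintro ⟨a⟩ ⟨b⟩; rfl, by rintro ⟨a⟩; rfl⟩

theorem hom_ext {f g : FreeAdmissible k X →ₐ[k] B} (hf : IsAdmissibleHom k f)
    (hg : IsAdmissibleHom k g) (h : ∀ x, f (of x) = g (of x)) : f = g := by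
  refine AlgHom.ext ?_
  rintro ⟨a⟩
  induction a with
  | var x => exact h x
  | scalar r => exact (f.commutes r).trans (g.commutes r).symm
  | add a b iha ihb => exact (map_add f _ _).trans ((congrArg₂ _ iha ihb).trans (map_add g _ _).symm)
  | mul a b iha ihb => exact (map_mul f _ _).trans ((congrArg₂ _ iha ihb).trans (map_mul g _ _).symm)
  | star a b iha ihb =>
    exact (hf.1 _ _).trans ((congrArg₂ (fun x y => SpecialAdmissible.star (k := k) x y)
      iha ihb).trans (hg.1 _ _).symm)
  | D a iha => exact (hf.2 _).trans ((congrArg _ iha).trans (hg.2 _).symm)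

end FreeAdmissible

namespace FreeGDNP

variable {k : Type u} {X : Type v} [Field k] {B : Type w} [CommRing B] [Algebra k B]
  [GDNPoisson k B]

theorem hom_ext {f g : FreeGDNP k X →ₐ[k] B} (hf : IsGDNPHom k f)
    (hg : IsGDNPHom k g) (h : ∀ x, f (of x) = g (of x)) : f = g := by
  refine AlgHom.ext ?_
  rintro ⟨a⟩
  induction a with
  | var x => exact h x
  | scalar r => exact (f.commutes r).trans (g.commutes r).symm
  | add a b iha ihb => exact (map_add f _ _).trans ((congrArg₂ _ iha ihb).trans (map_add g _ _).symm)
  | mul a b iha ihb => exact (map_mul f _ _).trans ((congrArg₂ _ iha ihb).trans (map_mul g _ _).symm)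
  | circ a b iha ihb =>
    exact (hf _ _).trans ((congrArg₂ (fun x y => GDNPoisson.circ (k := k) x y)
      iha ihb).trans (hg _ _).symm)

end FreeGDNP

/-! ## Every GDN-Poisson algebra embeds into a special GDN-Poisson admissible algebra -/

section Laurent

open LaurentPolynomial

variable (k : Type u) [Field k] (A : Type v) [CommRing A] [Algebra k A]

/-- The inclusion of the constant Laurent polynomials. -/
noncomputable def laurentC : A →ₐ[k] A[T;T⁻¹] where
  __ := (C : A →+* A[T;T⁻¹])
  commutes' _ := rfl

theorem laurentC_injective : Function.Injective (laurentC k A) := fun x y h => by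
  have h0 := congrArg (fun p : A[T;T⁻¹] => p.coeff 0) (show C x = C y from h)
  simpa only [C_apply, if_true] using h0

variable [GDNPoisson k A]

/-- The operation `D (a Tⁿ) = (e ∘ a + n a (e ∘ e)) Tⁿ⁻¹` on Laurent polynomials. -/
noncomputable def laurentD : A[T;T⁻¹] →ₗ[k] A[T;T⁻¹] :=
  (Finsupp.lsum k fun n : ℤ => AddMonoidAlgebra.lsingle (n - 1) ∘ₗ
    (GDNPoisson.circ (k := k) (1 : A) +
      n • LinearMap.mulRight k (GDNPoisson.circ (k := k) (1 : A) 1))) ∘ₗ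
    (AddMonoidAlgebra.coeffLinearEquiv k).toLinearMap

theorem laurentD_C_mul_T (a : A) (n : ℤ) :
    laurentD k A (C a * T n) =
      C (GDNPoisson.circ (k := k) 1 a + n * (a * GDNPoisson.circ (k := k) (1 : A) 1)) *
        T (n - 1) := by
  rw [← single_eq_C_mul_T, ← single_eq_C_mul_T]
  simp [laurentD, -single_eq_C_mul_T]

theorem laurentD_one : laurentD k A 1 = C (GDNPoisson.circ (k := k) (1 : A) 1) * T (-1) := by
  simpa using laurentD_C_mul_T k A 1 0

/-- By bilinearity monomials suffice. There the exponents add, which matches the terms n a d(e), and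
the rest is the corrected Leibniz rule of e ∘ - in A. -/
theorem laurentD_mul (x y : A[T;T⁻¹]) :
    laurentD k A (x * y) =
      laurentD k A x * y + x * laurentD k A y - x * y * laurentD k A 1 := by
  induction x using LaurentPolynomial.induction_on' with
  | add p q hp hq => rw [add_mul, map_add, hp, hq, map_add]; ring
  | C_mul_T m a =>
    induction y using LaurentPolynomial.induction_on' with
    | add p q hp hq => rw [mul_add, map_add, hp, hq, map_add]; ring
    | C_mul_T n b =>
      have e : C a * T m * (C b * T n) = C (a * b) * T (m + n) := by
        rw [T_add, map_mul]; ring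
      rw [e, laurentD_one, laurentD_C_mul_T, laurentD_C_mul_T, laurentD_C_mul_T,
        GDNPoisson.one_circ_mul]
      simp only [sub_eq_add_neg, T_add, map_add, map_mul, map_neg, map_intCast, Int.cast_add]
      ring

/-- Laurent polynomials over a GDN-Poisson algebra form a special GDN-Poisson admissible algebra,
with `x ∗ y = x y T`. -/
noncomputable instance laurentAdmissible : SpecialAdmissible k A[T;T⁻¹] where
  star := (LinearMap.mul k A[T;T⁻¹]).compr₂ (LinearMap.mulRight k (T 1))
  D := laurentD k A
  star_comm x y := by
    simp only [LinearMap.compr₂_apply, LinearMap.mul_apply', LinearMap.mulRight_apply]; ring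
  star_assoc x y z := by
    simp only [LinearMap.compr₂_apply, LinearMap.mul_apply', LinearMap.mulRight_apply]; ring
  mul_star x y z := by
    simp only [LinearMap.compr₂_apply, LinearMap.mul_apply', LinearMap.mulRight_apply]; ring
  D_star x y := by
    -- Expanding D(x y T) by the corrected rule twice subtracts x y T (D e) twice, so the Leibniz
    -- rule for ∗ needs exactly D T = 2 T (D e). One copy of e ∘ e comes from e ∘ 1, the other from
    -- the coefficient n = 1.
    have hT : laurentD k A (T 1) = 2 * (T 1 * laurentD k A 1) := by
      have h := laurentD_C_mul_T k A 1 1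
      rw [map_one, one_mul] at h
      rw [h, laurentD_one]
      have e : (T 1 : A[T;T⁻¹]) * T (-1) = 1 := by rw [← T_add]; simp
      simp only [one_mul, Int.cast_one, map_add, sub_self, T_zero, mul_one]
      linear_combination (-2 * C (GDNPoisson.circ (k := k) (1 : A) 1)) * e
    simp only [LinearMap.compr₂_apply, LinearMap.mul_apply', LinearMap.mulRight_apply,
      laurentD_mul, hT]
    ring
  D_mul := laurentD_mul k A

/-- On constants the factor T⁻¹ produced by D cancels the factor T of ∗. -/
theorem isGDNPHom_laurentC : IsGDNPHom k (laurentC k A) := fun x y => by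
  have h := laurentD_C_mul_T k A y 0
  rw [T_zero, mul_one] at h
  change C _ = C x * laurentD k A (C y) * T 1
  rw [h, GDNPoisson.circ_eq_mul, map_mul, mul_assoc, mul_assoc, ← T_add]
  simp

end Laurent

/-! ## The words of weight zero -/

section WordsOfWeightZero

variable {k : Type u} [Field k] {X : Type v}

open AdmissibleWord SpecialAdmissible

variable (k) in
/-- The element `tⁱ Dⁱ a` of `C(X)`, for a letter `Dⁱ a`, where `t = e ∗ e`. -/
def balancedLetter (l : DLetter X) : FreeAdmissible k X :=
  star (k := k) (1 : FreeAdmissible k X) 1 ^ l.1 * letterVal k l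

theorem letterVal_succ (i : ℕ) (a : Option X) :
    letterVal k (i + 1, a) = D (k := k) (letterVal k (i, a)) := by
  cases a <;> exact Function.iterate_succ_apply' _ _ _

theorem letterVal_unit : letterVal k ((0, none) : DLetter X) = 1 := rfl

/-- Each ∗ contributes one factor t, so only the number of stars and the product of the letters
matter. -/
theorem AdmissibleWord.val_eq (w : AdmissibleWord X) :
    w.val k = star (k := k) (1 : FreeAdmissible k X) 1 ^ w.stars.length *
      ((w.head :: w.stars ++ w.dots).map (letterVal k)).prod := by
  have hd : ∀ (L : List (DLetter X)) (f : FreeAdmissible k X),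
      L.foldl (fun f l => f * letterVal k l) f = f * (L.map (letterVal k)).prod := by
    intro L
    induction L with
    | nil => simp
    | cons l L ih => intro f; simp [ih, mul_assoc]
  have hs : ∀ (L : List (DLetter X)) (f : FreeAdmissible k X),
      L.foldl (fun f l => star (k := k) f (letterVal k l)) f =
        star (k := k) (1 : FreeAdmissible k X) 1 ^ L.length *
          (f * (L.map (letterVal k)).prod) := by
    intro L
    induction L with
    | nil => simp
    | cons l L ih =>
      intro f
      rw [List.foldl_cons, ih, star_eq_mul k f, List.length_cons, List.map_cons, List.prod_cons]
      ring
  rw [AdmissibleWord.val, hd, hs]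
  simp [mul_assoc]

/-- The powers of t add up to the total number of D's. In a word of weight 0 this is the number of
stars, so its factors t can be shared out as one per D. -/
theorem prod_balancedLetter (L : List (DLetter X)) :
    (L.map (balancedLetter k)).prod =
      star (k := k) (1 : FreeAdmissible k X) 1 ^ (L.map Prod.fst).sum *
        (L.map (letterVal k)).prod := by
  induction L with
  | nil => simp
  | cons l L ih =>
    simp only [List.map_cons, List.prod_cons, List.sum_cons, ih, balancedLetter, pow_add]
    ring

theorem AdmissibleWord.wt_eq_zero_iff (w : AdmissibleWord X) :
    w.wt = 0 ↔ ((w.head :: w.stars ++ w.dots).map Prod.fst).sum = w.stars.length := by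
  have h : ∀ L : List (DLetter X),
      (L.map fun l => (l.1 : ℤ)).sum = ((L.map Prod.fst).sum : ℕ) := by
    intro L
    induction L with
    | nil => simp
    | cons l L ih => simp [ih]
  rw [AdmissibleWord.wt, h, sub_eq_zero, Nat.cast_inj]

/-- A product of balanced letters is the value of a word of weight `0`. -/
theorem exists_word_of_prod_balancedLetter (L : List (DLetter X)) :
    ∃ w : AdmissibleWord X, w.wt = 0 ∧ w.val k = (L.map (balancedLetter k)).prod := by
  classical
  -- Letters D⁰e contribute the factor 1. They are deleted because a word with a nonempty dot part
  -- may not contain them.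
  wlog hL : ∀ l ∈ L, l ≠ (0, none) generalizing L
  · obtain ⟨w, hw, hv⟩ := this (L.filter fun l => l ≠ (0, none)) fun l hl => by
      simpa using (List.mem_filter.mp hl).2
    refine ⟨w, hw, hv.trans ?_⟩
    clear hL this hv
    induction L with
    | nil => rfl
    | cons l L ih =>
      by_cases h : l = (0, none)
      · rw [List.filter_cons_of_neg (by simpa using h), ih]
        simp [h, balancedLetter, letterVal_unit]
      · rw [List.filter_cons_of_pos (by simpa using h), List.map_cons, List.prod_cons, ih,
          List.map_cons, List.prod_cons]
  cases L with
  | nil =>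
    refine ⟨⟨(0, none), [], [], by simp⟩, by simp [wt_eq_zero_iff], ?_⟩
    simp [val_eq, letterVal_unit]
  | cons a L =>
    rw [prod_balancedLetter]
    set m := ((a :: L).map Prod.fst).sum with hm
    -- Exactly m stars are needed for weight 0. If at least m letters follow the head, the first m
    -- of them are joined by ∗ and the others by the unital product.
    by_cases hmL : m ≤ L.length
    · refine ⟨⟨a, L.take m, L.drop m, fun _ => by simpa using hL⟩, ?_, ?_⟩
      · rw [wt_eq_zero_iff]
        simpa [hmL] using hm.symm
      · rw [val_eq]
        simp [hmL]
    -- With too few letters the word is padded by letters e, each of which adds a star and no D.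
    -- There are no dots, so unit letters are allowed.
    · refine ⟨⟨a, L ++ List.replicate (m - L.length) (0, none), [], by simp⟩, ?_, ?_⟩
      · rw [wt_eq_zero_iff]
        simp only [List.map_cons, List.sum_cons] at hm
        simp only [List.append_nil, List.map_cons, List.map_append, List.map_replicate,
          List.sum_cons, List.sum_append, List.sum_replicate, List.length_append,
          List.length_replicate, smul_zero]
        omega
      · rw [val_eq]
        have : L.length + (m - L.length) = m := by omega
        simp [this, letterVal_unit]

/-- The values of weight-0 words are exactly the finite products of balanced letters, that is, the
submonoid whose span is the generated subalgebra. -/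
theorem gdnpZero_eq_adjoin :
    gdnpZero k X =
      Subalgebra.toSubmodule (Algebra.adjoin k (Set.range (balancedLetter k (X := X)))) := by
  apply le_antisymm
  · refine Submodule.span_le.mpr ?_
    rintro _ ⟨w, hw, rfl⟩
    rw [val_eq, ← w.wt_eq_zero_iff.mp hw, ← prod_balancedLetter]
    refine Subalgebra.list_prod_mem _ fun f hf => ?_
    obtain ⟨l, -, rfl⟩ := List.mem_map.mp hf
    exact Algebra.subset_adjoin ⟨l, rfl⟩
  · rw [Algebra.adjoin_eq_span]
    refine Submodule.span_mono fun f hf => ?_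
    obtain ⟨L, hL, rfl⟩ := Submonoid.exists_list_of_mem_closure hf
    obtain ⟨L, rfl⟩ : L ∈ Set.range (List.map (balancedLetter k (X := X))) := by
      rw [Set.range_list_map]
      exact hL
    exact exists_word_of_prod_balancedLetter L

theorem balancedLetter_one_none :
    balancedLetter k ((1, none) : DLetter X) = GDNPoisson.circ (k := k) 1 1 := by
  rw [circ_def, star_eq_mul, balancedLetter, letterVal_succ, letterVal_unit]
  ring

/-- Since e ∘ y = t (D y), this is t times the formula for D(tⁱ y) with y = Dⁱ a, solved for the
term tⁱ⁺¹ (D y). -/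
theorem balancedLetter_succ (i : ℕ) (a : Option X) :
    balancedLetter k (i + 1, a) =
      GDNPoisson.circ (k := k) 1 (balancedLetter k (i, a)) -
        (i : FreeAdmissible k X) *
          (GDNPoisson.circ (k := k) 1 1 * balancedLetter k (i, a)) := by
  -- Each factor t brings 2 (D e) from D t and loses one D e to the correction in `D_mul`; the net
  -- gain is one D e per factor.
  have hD : ∀ (i : ℕ) (y : FreeAdmissible k X),
      D (k := k) (star (k := k) (1 : FreeAdmissible k X) 1 ^ i * y) =
        star (k := k) (1 : FreeAdmissible k X) 1 ^ i * (D (k := k) y + i * D (k := k) 1 * y) := by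
    intro i
    induction i with
    | zero => simp
    | succ i ih =>
      intro y
      rw [pow_succ', mul_assoc, D_mul, ih, D_star_one_one]
      push_cast
      ring
  rw [balancedLetter, letterVal_succ, balancedLetter, circ_def, circ_def, star_eq_mul k 1 (D _),
    star_eq_mul k 1 (D _), hD]
  ring

/-- As x ∘ y = x·(e ∘ y), it is enough that e ∘ - preserves the subalgebra. The product rule reduces
this to generators, where the recurrence for balanced letters applies; the correction term stays
inside because e ∘ e = t (D e) is itself a balanced letter. -/
theorem circ_mem_gdnpZero {x y : FreeAdmissible k X} (hx : x ∈ gdnpZero k X)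
    (hy : y ∈ gdnpZero k X) : GDNPoisson.circ (k := k) x y ∈ gdnpZero k X := by
  rw [gdnpZero_eq_adjoin, Subalgebra.mem_toSubmodule] at *
  rw [GDNPoisson.circ_eq_mul]
  refine mul_mem hx ?_
  have hb : ∀ l, balancedLetter k l ∈ Algebra.adjoin k (Set.range (balancedLetter k (X := X))) :=
    fun l => Algebra.subset_adjoin ⟨l, rfl⟩
  induction hy using Algebra.adjoin_induction with
  | mem y hy =>
    obtain ⟨⟨i, a⟩, rfl⟩ := hy
    rw [← sub_add_cancel (GDNPoisson.circ (k := k) 1 _) _, ← balancedLetter_succ,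
      ← balancedLetter_one_none]
    exact add_mem (hb _) (mul_mem (natCast_mem _ _) (mul_mem (hb _) (hb _)))
  | algebraMap r =>
    rw [Algebra.algebraMap_eq_smul_one, map_smul, ← balancedLetter_one_none]
    exact Subalgebra.smul_mem _ (hb _) _
  | add y z _ _ ihy ihz => rw [map_add]; exact add_mem ihy ihz
  | mul y z hy hz ihy ihz =>
    rw [GDNPoisson.one_circ_mul, ← balancedLetter_one_none]
    exact sub_mem (add_mem (mul_mem ihy hz) (mul_mem hy ihz)) (mul_mem (mul_mem hy hz) (hb _))

end WordsOfWeightZero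

/-! ### Comparison of GDNP(X|S) with C(X|S) -/

section Embedding

variable {k : Type u} [Field k] {X : Type v}

theorem isGDNPHom_gdnpToAdmissible : IsGDNPHom k (gdnpToAdmissible k X) :=
  FreeGDNP.isGDNPHom_lift _

/-- A homomorphism `GDNP(X) → B` extends to a homomorphism `C(X) → B`. -/
theorem FreeAdmissible.lift_comp_gdnpToAdmissible {B : Type w} [CommRing B] [Algebra k B]
    [SpecialAdmissible k B] {f : FreeGDNP k X →ₐ[k] B} (hf : IsGDNPHom k f) :
    (FreeAdmissible.lift (k := k) fun x => f (FreeGDNP.of x)).comp (gdnpToAdmissible k X) = f :=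
  FreeGDNP.hom_ext ((FreeAdmissible.isAdmissibleHom_lift _).isGDNPHom.comp
    isGDNPHom_gdnpToAdmissible) hf fun _ => rfl

/-- If `f` vanishes on `S`, then its extension to `C(X)` vanishes on `Id[φ(S)]`. -/
theorem FreeAdmissible.admissibleIdeal_le_ker_lift {B : Type w} [CommRing B] [Algebra k B]
    [SpecialAdmissible k B] {f : FreeGDNP k X →ₐ[k] B} (hf : IsGDNPHom k f)
    {S : Set (FreeGDNP k X)} (hS : ∀ s ∈ S, f s = 0) :
    admissibleIdeal k (gdnpToAdmissible k X '' S) ≤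
      RingHom.ker (FreeAdmissible.lift (k := k) fun x => f (FreeGDNP.of x)) := by
  refine admissibleIdeal_le ?_ (FreeAdmissible.isAdmissibleHom_lift _).isAdmissibleIdeal_ker
  rintro _ ⟨s, hs, rfl⟩
  exact (DFunLike.congr_fun (FreeAdmissible.lift_comp_gdnpToAdmissible hf) s).trans (hS s hs)

/-- The core of the theorem: passing to the larger algebra C(X), with its larger supply of
operations, adds no consequences of S inside GDNP(X). -/
theorem gdnpToAdmissible_mem_admissibleIdeal_iff (S : Set (FreeGDNP k X)) (a : FreeGDNP k X) :
    gdnpToAdmissible k X a ∈ admissibleIdeal k (gdnpToAdmissible k X '' S) ↔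
      a ∈ gdnpIdeal k S := by
  constructor
  · intro ha
    -- The test algebra is the Laurent extension of GDNP(X|S). The extension of this map to C(X)
    -- kills Id[φ(S)], while its restriction to GDNP(X) has kernel exactly Id(S), the constants
    -- being embedded.
    have hf : IsGDNPHom k ((laurentC k (PresentedGDNP k S)).comp
        (Ideal.Quotient.mkₐ k (gdnpIdeal k S))) :=
      (isGDNPHom_laurentC k _).comp (isGDNPHom_mk S)
    have h := FreeAdmissible.admissibleIdeal_le_ker_lift hf (S := S) (fun s hs => by
      rw [AlgHom.comp_apply, Ideal.Quotient.mkₐ_eq_mk,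
        Ideal.Quotient.eq_zero_iff_mem.mpr (subset_gdnpIdeal S hs), map_zero]) ha
    have h' := (DFunLike.congr_fun (FreeAdmissible.lift_comp_gdnpToAdmissible hf) a).symm.trans h
    rw [AlgHom.comp_apply, map_eq_zero_iff _ (laurentC_injective k _)] at h'
    exact Ideal.Quotient.eq_zero_iff_mem.mp h'
  · intro ha
    -- The preimage of Id[φ(S)] in GDNP(X) is the kernel of a GDN-Poisson homomorphism, hence an
    -- ideal containing S.
    have hker := ((isAdmissibleHom_mk (k := k)
      (gdnpToAdmissible k X '' S)).isGDNPHom.comp isGDNPHom_gdnpToAdmissible).isGDNPIdeal_ker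
    have h := gdnpIdeal_le (S := S) (fun s hs => Ideal.Quotient.eq_zero_iff_mem.mpr
      (subset_admissibleIdeal _ (Set.mem_image_of_mem _ hs))) hker ha
    exact Ideal.Quotient.eq_zero_iff_mem.mp h

/-- The embedding of GDNP(X) into its Laurent extension factors through φ. -/
theorem gdnpToAdmissible_injective : Function.Injective (gdnpToAdmissible k X) := by
  have hf : IsGDNPHom k (laurentC k (FreeGDNP k X)) := isGDNPHom_laurentC k _
  refine Function.Injective.of_comp (f := FreeAdmissible.lift (k := k)
    fun x => laurentC k (FreeGDNP k X) (FreeGDNP.of x)) ?_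
  rw [← AlgHom.coe_comp, FreeAdmissible.lift_comp_gdnpToAdmissible hf]
  exact laurentC_injective k _

theorem range_gdnpToAdmissible :
    Set.range (gdnpToAdmissible k X) = (gdnpZero k X : Set (FreeAdmissible k X)) := by
  have hb : ∀ l : DLetter X,
      balancedLetter k l ∈ Algebra.adjoin k (Set.range (balancedLetter k (X := X))) :=
    fun l => Algebra.subset_adjoin ⟨l, rfl⟩
  apply Set.Subset.antisymm
  · rintro _ ⟨⟨a⟩, rfl⟩
    change gdnpToAdmissible k X (FreeGDNP.mk a) ∈ gdnpZero k X
    induction a with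
    | var x =>
      rw [gdnpZero_eq_adjoin]
      have h := hb (0, some x)
      rw [balancedLetter, pow_zero, one_mul] at h
      exact h
    | scalar r =>
      rw [gdnpZero_eq_adjoin]
      exact Subalgebra.algebraMap_mem _ r
    | add a b iha ihb => exact add_mem iha ihb
    | mul a b iha ihb =>
      rw [gdnpZero_eq_adjoin] at *
      exact Subalgebra.mul_mem _ iha ihb
    | circ a b iha ihb => exact circ_mem_gdnpZero iha ihb
  -- The range of φ is a subalgebra stable under e ∘ -, so the recurrence produces every balanced
  -- letter from e and X.
  · have h : Algebra.adjoin k (Set.range (balancedLetter k (X := X))) ≤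
        (gdnpToAdmissible k X).range := by
      refine Algebra.adjoin_le ?_
      rintro _ ⟨⟨i, a⟩, rfl⟩
      have hcirc : ∀ b ∈ (gdnpToAdmissible k X).range,
          GDNPoisson.circ (k := k) 1 b ∈ (gdnpToAdmissible k X).range := by
        rintro _ ⟨b, rfl⟩
        exact ⟨GDNPoisson.circ (k := k) 1 b, by
          simpa using isGDNPHom_gdnpToAdmissible (k := k) (X := X) 1 b⟩
      change balancedLetter k (i, a) ∈ (gdnpToAdmissible k X).range
      induction i with
      | zero =>
        rw [balancedLetter, pow_zero, one_mul]
        cases a with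
        | none => exact one_mem _
        | some x => exact ⟨FreeGDNP.of x, rfl⟩
      | succ i ih =>
        rw [balancedLetter_succ]
        exact sub_mem (hcirc _ ih) (mul_mem (natCast_mem _ _) (mul_mem (hcirc _ (one_mem _)) ih))
    rw [gdnpZero_eq_adjoin]
    exact h

theorem gdnpIdealOf_gdnpZero (S : Set (FreeGDNP k X)) :
    gdnpIdealOf k (gdnpZero k X) (gdnpToAdmissible k X '' S) =
      gdnpZero k X ⊓
        (admissibleIdeal k (gdnpToAdmissible k X '' S)).restrictScalars k := by
  have hmem : ∀ a, gdnpToAdmissible k X a ∈ gdnpZero k X := fun a => by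
    rw [← SetLike.mem_coe, ← range_gdnpToAdmissible]
    exact ⟨a, rfl⟩
  have hpre : ∀ x ∈ gdnpZero k X, ∃ a, gdnpToAdmissible k X a = x := fun x hx => by
    rwa [← SetLike.mem_coe, ← range_gdnpToAdmissible] at hx
  have hcirc := isGDNPHom_gdnpToAdmissible (k := k) (X := X)
  apply le_antisymm
  · refine sInf_le ⟨?_, inf_le_left, ?_⟩
    · rintro _ ⟨s, hs, rfl⟩
      exact ⟨hmem s, subset_admissibleIdeal _ ⟨s, hs, rfl⟩⟩
    · rintro x ⟨hx0, hx⟩ b hb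
      obtain ⟨a, rfl⟩ := hpre x hx0
      obtain ⟨b, rfl⟩ := hpre b hb
      replace hx := (gdnpToAdmissible_mem_admissibleIdeal_iff S a).mp hx
      have hI := isGDNPIdeal_gdnpIdeal k S a hx b
      rw [← map_mul, ← hcirc, ← hcirc]
      exact ⟨⟨hmem _, (gdnpToAdmissible_mem_admissibleIdeal_iff S _).mpr
          (Ideal.mul_mem_right _ _ hx)⟩,
        ⟨hmem _, (gdnpToAdmissible_mem_admissibleIdeal_iff S _).mpr hI.1⟩,
        ⟨hmem _, (gdnpToAdmissible_mem_admissibleIdeal_iff S _).mpr hI.2⟩⟩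
  · refine le_sInf ?_
    rintro J ⟨hSJ, -, hJ⟩ x ⟨hx0, hx⟩
    obtain ⟨a, rfl⟩ := hpre x hx0
    replace hx := (gdnpToAdmissible_mem_admissibleIdeal_iff S a).mp hx
    -- The competitor J is pulled back to GDNP(X). It absorbs only multipliers from GDNP₀(X), which
    -- is enough because φ takes all its values there.
    let I : Ideal (FreeGDNP k X) :=
      { (J.comap (gdnpToAdmissible k X).toLinearMap).toAddSubmonoid with
        smul_mem' := fun c y hy => by
          change gdnpToAdmissible k X (c * y) ∈ J
          rw [mul_comm, map_mul]
          exact (hJ _ hy _ (hmem c)).1 }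
    have hI : IsGDNPIdeal k I := fun y hy b => by
      change gdnpToAdmissible k X _ ∈ J ∧ gdnpToAdmissible k X _ ∈ J
      rw [hcirc, hcirc]
      exact (hJ _ hy _ (hmem b)).2
    exact gdnpIdeal_le (S := S) (I := I) (fun s hs => hSJ ⟨s, hs, rfl⟩) hI hx

/-- The homomorphism `GDNP(X|S) → C(X|S)` induced by `GDNP(X) → C(X)`. -/
def presentedGDNPToAdmissible (S : Set (FreeGDNP k X)) :
    PresentedGDNP k S →ₐ[k] PresentedAdmissible k S :=
  Ideal.Quotient.liftₐ (gdnpIdeal k S)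
    ((Ideal.Quotient.mkₐ k (admissibleIdeal k (gdnpToAdmissible k X '' S))).comp
      (gdnpToAdmissible k X))
    fun a ha => Ideal.Quotient.eq_zero_iff_mem.mpr
      ((gdnpToAdmissible_mem_admissibleIdeal_iff S a).mpr ha)

theorem presentedGDNPToAdmissible_mk (S : Set (FreeGDNP k X)) (a : FreeGDNP k X) :
    presentedGDNPToAdmissible S (Ideal.Quotient.mk _ a) =
      Ideal.Quotient.mk _ (gdnpToAdmissible k X a) := rfl

theorem presentedGDNPToAdmissible_injective (S : Set (FreeGDNP k X)) :
    Function.Injective (presentedGDNPToAdmissible S) := by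
  rw [injective_iff_map_eq_zero]
  intro a ha
  obtain ⟨a, rfl⟩ := Ideal.Quotient.mk_surjective a
  rw [presentedGDNPToAdmissible_mk, Ideal.Quotient.eq_zero_iff_mem,
    gdnpToAdmissible_mem_admissibleIdeal_iff] at ha
  exact Ideal.Quotient.eq_zero_iff_mem.mpr ha

/-- The restriction of f to the generators extends to C(X) by freeness and kills Id[φ(S)], hence
descends to C(X|S). Uniqueness holds because the images of X generate C(X|S) under the admissible
operations. -/
theorem existsUnique_admissibleHom (S : Set (FreeGDNP k X)) {B : Type w} [CommRing B]
    [Algebra k B] [SpecialAdmissible k B] (f : PresentedGDNP k S →ₐ[k] B) (hf : IsGDNPHom k f) :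
    ∃! g : PresentedAdmissible k S →ₐ[k] B,
      IsAdmissibleHom k g ∧ g.comp (presentedGDNPToAdmissible S) = f := by
  have hf' : IsGDNPHom k (f.comp (Ideal.Quotient.mkₐ k (gdnpIdeal k S))) :=
    hf.comp (isGDNPHom_mk S)
  have hlift := FreeAdmissible.isAdmissibleHom_lift (k := k)
    fun x => f.comp (Ideal.Quotient.mkₐ k (gdnpIdeal k S)) (FreeGDNP.of x)
  refine ⟨Ideal.Quotient.liftₐ _ (FreeAdmissible.lift
    fun x => f.comp (Ideal.Quotient.mkₐ k (gdnpIdeal k S)) (FreeGDNP.of x)) fun a ha =>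
      FreeAdmissible.admissibleIdeal_le_ker_lift hf' (fun s hs => ?_) ha, ⟨⟨?_, ?_⟩, ?_⟩, ?_⟩
  · rw [AlgHom.comp_apply, Ideal.Quotient.mkₐ_eq_mk,
      Ideal.Quotient.eq_zero_iff_mem.mpr (subset_gdnpIdeal S hs), map_zero]
  · intro x y
    obtain ⟨x, rfl⟩ := Ideal.Quotient.mk_surjective x
    obtain ⟨y, rfl⟩ := Ideal.Quotient.mk_surjective y
    exact hlift.1 x y
  · intro x
    obtain ⟨x, rfl⟩ := Ideal.Quotient.mk_surjective x
    exact hlift.2 x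
  · refine AlgHom.ext fun a => ?_
    obtain ⟨a, rfl⟩ := Ideal.Quotient.mk_surjective a
    exact DFunLike.congr_fun (FreeAdmissible.lift_comp_gdnpToAdmissible hf') a
  · rintro g ⟨hg, rfl⟩
    refine AlgHom.ext fun a => ?_
    obtain ⟨a, rfl⟩ := Ideal.Quotient.mk_surjective a
    have hg' : IsAdmissibleHom k (g.comp (Ideal.Quotient.mkₐ k _)) :=
      ⟨fun x y => hg.1 (Ideal.Quotient.mk _ x) (Ideal.Quotient.mk _ y),
        fun x => hg.2 (Ideal.Quotient.mk _ x)⟩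
    exact DFunLike.congr_fun (FreeAdmissible.hom_ext hg' hlift fun x => rfl) a

end Embedding

/-! ### Presentations of arbitrary GDN-Poisson algebras -/

theorem exists_presentation {k : Type u} [Field k] (A : Type v) [CommRing A] [Algebra k A]
    [GDNPoisson k A] :
    ∃ (X : Type v) (S : Set (FreeGDNP k X)) (e : PresentedGDNP k S ≃ₐ[k] A),
      IsGDNPHom k (e : PresentedGDNP k S →ₐ[k] A) := by
  have hp : IsGDNPHom k (FreeGDNP.lift (k := k) (id : A → A)) := FreeGDNP.isGDNPHom_lift _
  have hle : gdnpIdeal k (RingHom.ker (FreeGDNP.lift (k := k) (id : A → A)) :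
      Set (FreeGDNP k A)) ≤ RingHom.ker (FreeGDNP.lift (k := k) (id : A → A)) :=
    gdnpIdeal_le subset_rfl hp.isGDNPIdeal_ker
  -- Every element of A serves as a generator and every element of the kernel of evaluation as a
  -- relation. The kernel is already an ideal for ∘, so generating an ideal from it adds nothing.
  refine ⟨A, RingHom.ker (FreeGDNP.lift (k := k) (id : A → A)),
    AlgEquiv.ofBijective (Ideal.Quotient.liftₐ _ (FreeGDNP.lift (k := k) (id : A → A))
      fun a ha => hle ha) ⟨?_, fun a => ⟨Ideal.Quotient.mk _ (FreeGDNP.of a), rfl⟩⟩, ?_⟩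
  · rw [injective_iff_map_eq_zero]
    intro a ha
    obtain ⟨a, rfl⟩ := Ideal.Quotient.mk_surjective a
    exact Ideal.Quotient.eq_zero_iff_mem.mpr (subset_gdnpIdeal _ ha)
  · intro x y
    obtain ⟨x, rfl⟩ := Ideal.Quotient.mk_surjective x
    obtain ⟨y, rfl⟩ := Ideal.Quotient.mk_surjective y
    exact hp x y

theorem theorem3p1 {k : Type u} [Field k] :
    (∀ (X : Type v) (S : Set (FreeGDNP k X)),
      -- `GDNP(X)` is isomorphic to `GDNP₀(X)`
      (Function.Injective (gdnpToAdmissible k X) ∧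
        Set.range (gdnpToAdmissible k X) = (gdnpZero k X : Set (FreeAdmissible k X))) ∧
      -- the ideal of `GDNP₀(X)` generated by `S` is `GDNP₀(X) ∩ Id[S]`
      gdnpIdealOf k (gdnpZero k X) (gdnpToAdmissible k X '' S) =
        gdnpZero k X ⊓ (admissibleIdeal k (gdnpToAdmissible k X '' S)).restrictScalars k ∧
      -- `GDNP(X|S)` embeds into `C(X|S)`, which is its universal enveloping algebra
      ∃ ι : PresentedGDNP k S →ₐ[k] PresentedAdmissible k S,
        (∀ x : X, ι (Ideal.Quotient.mk _ (FreeGDNP.of x)) =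
          Ideal.Quotient.mk _ (FreeAdmissible.of x)) ∧
        (∀ a b : PresentedGDNP k S, ι (GDNPoisson.circ (k := k) a b) =
          SpecialAdmissible.star (k := k) (ι a) (SpecialAdmissible.D (k := k) (ι b))) ∧
        Function.Injective ι ∧
        ∀ (B : Type w) [CommRing B] [Algebra k B] [SpecialAdmissible k B]
          (f : PresentedGDNP k S →ₐ[k] B), IsGDNPHom k f →
          ∃! g : PresentedAdmissible k S →ₐ[k] B, IsAdmissibleHom k g ∧ g.comp ι = f) ∧
    -- every GDN-Poisson algebra is of the form `GDNP(X|S)`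
    (∀ (A : Type v) [CommRing A] [Algebra k A] [GDNPoisson k A],
      ∃ (X : Type v) (S : Set (FreeGDNP k X)) (e : PresentedGDNP k S ≃ₐ[k] A),
        IsGDNPHom k (e : PresentedGDNP k S →ₐ[k] A)) := by
  refine ⟨fun X S => ⟨⟨gdnpToAdmissible_injective, range_gdnpToAdmissible⟩,
    gdnpIdealOf_gdnpZero S, presentedGDNPToAdmissible S, fun _ => rfl, fun a b => ?_,
    presentedGDNPToAdmissible_injective S,
    fun B _ _ _ f hf => existsUnique_admissibleHom S f hf⟩, fun A _ _ _ => exists_presentation A⟩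
  obtain ⟨a, rfl⟩ := Ideal.Quotient.mk_surjective a
  obtain ⟨b, rfl⟩ := Ideal.Quotient.mk_surjective b
  exact congrArg (Ideal.Quotient.mk _) (isGDNPHom_gdnpToAdmissible (k := k) (X := X) a b)
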